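/- Let $V:\mathbb Z\to\mathbb R$ be arbitrary and let $H=\Delta+V$, $(H\psi)(n)=\psi(n+1)+\psi(n-1)+V(n)\psi(n)$, be the associated self-adjoint discrete Schrödinger operator on $\ell^2(\mathbb Z)$, with domain $\{\psi\in\ell^2(\mathbb Z): H\psi\in\ell^2(\mathbb Z)\}$. Let $J\subset\mathbb R$ be an open interval such that the spectrum of $H$ in $J$ is pure point (that is, the range of the spectral projector $\mathbf 1_J(H)$ lies in the closed linear span of the eigenvectors of $H$) and $\mathbf 1_J(H)e_0=0$, where $e_0$ is the standard basis vector at the origin. For $\psi\in\ell^2(\mathbb Z)$ let $\psi_+$ and $\psi_-$ be the restrictions of $\psi$ to $\{n>0\}$ and $\{n<0\}$, extended by zero. Then: 1. Let $H\varphi=\lambda\varphi$ and $H\psi=\mu\psi$ with $\lambda,\mu\in J$, $\lambda\ne\mu$, $\|\varphi\|=\|\psi\|=1$. Put $\delta=\delta(\varphi)=\min\{\|\varphi_+\|,\|\varphi_-\|\}$ and $m=\min\{\max\{\|\varphi_-\|,\|\psi_+\|\},\max\{\|\varphi_+\|,\|\psi_-\|\}\}$. Then $\delta>0$, $$m\le\max\{\|\varphi_+\|,\|\varphi_-\|\}\le\sqrt{1-\delta^2},\qquad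 \operatorname{dist}(\lambda,\partial J)\le\frac{|\lambda-\mu|}{\sqrt{1-m^2}}.$$ 2. No eigenvalue of $H$ contained in $J$ is a limit point of other eigenvalues of $H$. 3. The set $\sigma(H)\cap J$ contains no interval with more than one point. -/

import Mathlib

open scoped ENNReal Topology

noncomputable section

namespace Schrodinger

section Abstract

variable {E : Type*} [NormedAddCommGroup E] [InnerProductSpace ℂ E]

/-- `R` is a bounded two-sided inverse of `A - z`, for a (possibly unbounded) operator `A`. -/
def IsResolventAt (A : E →ₗ.[ℂ] E) (z : ℂ) (R : E →L[ℂ] E) : Prop :=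
  (∀ y : E, ∃ x : A.domain, (x : E) = R y ∧ A x - z • (x : E) = y) ∧
    ∀ x : A.domain, R (A x - z • (x : E)) = x

/-- The spectrum of a (possibly unbounded) operator `A`: the set of all `z` for which `A - z` has
no bounded everywhere defined inverse. -/
def unboundedSpectrum (A : E →ₗ.[ℂ] E) : Set ℂ :=
  {z | ¬ ∃ R : E →L[ℂ] E, IsResolventAt A z R}

open Classical in
/-- The resolvent `(A - z)⁻¹` (set to `0` when `z` belongs to the spectrum). -/
def unboundedResolvent (A : E →ₗ.[ℂ] E) (z : ℂ) : E →L[ℂ] E :=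
  if h : ∃ R : E →L[ℂ] E, IsResolventAt A z R then h.choose else 0

/-- `x` is an eigenvector (a nonzero one) of `A` with eigenvalue `z`. -/
def IsEigenvector (A : E →ₗ.[ℂ] E) (z : ℂ) (x : A.domain) : Prop :=
  (x : E) ≠ 0 ∧ A x = z • (x : E)

/-- `z` is an eigenvalue of `A`. -/
def IsEigenvalue (A : E →ₗ.[ℂ] E) (z : ℂ) : Prop :=
  ∃ x : A.domain, IsEigenvector A z x

variable [CompleteSpace E]

/-- The operator `f(A)`, for `A` self-adjoint and `f : ℝ → ℝ` continuous with compact support.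
With `W = (A - i)⁻¹`, a bounded normal operator, and `w = (x - i)⁻¹`, i.e. `x = w⁻¹ + i`, it is
the function `w ↦ f (w⁻¹ + i)` of `W`. This function is continuous on the spectrum of `W`, with the
value `0` (the value of `f` at infinity) at `w = 0`. -/
def functionOf (A : E →ₗ.[ℂ] E) (f : ℝ → ℝ) : E →L[ℂ] E :=
  cfc (fun w : ℂ => if w = 0 then (0 : ℂ) else ((f (w⁻¹ + Complex.I).re : ℝ) : ℂ))
    (unboundedResolvent A Complex.I)

/-- The range of the spectral projector `1_J(A)` of a self-adjoint operator `A`, for `J` open: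
the closed linear span of the ranges of all `f(A)`, where `f` is continuous with compact support
inside `J` (the indicator of the open set `J` is an increasing pointwise limit of such functions,
and `f = 1_J f`). -/
def spectralSubspace (A : E →ₗ.[ℂ] E) (J : Set ℝ) : Submodule ℂ E :=
  (Submodule.span ℂ {y : E | ∃ f : ℝ → ℝ, Continuous f ∧ HasCompactSupport f ∧ tsupport f ⊆ J ∧
    ∃ x : E, y = functionOf A f x}).topologicalClosure

instance (A : E →ₗ.[ℂ] E) (J : Set ℝ) : CompleteSpace (spectralSubspace A J) :=
  Submodule.topologicalClosure.completeSpace _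

/-- The spectral projector `1_J(A)` of a self-adjoint operator `A`, for `J` open. -/
def spectralProjector (A : E →ₗ.[ℂ] E) (J : Set ℝ) : E →L[ℂ] E :=
  (spectralSubspace A J).starProjection

/-- The pure point subspace of `A`: the closed linear span of all eigenvectors of `A`. -/
def purePointSubspace (A : E →ₗ.[ℂ] E) : Submodule ℂ E :=
  (Submodule.span ℂ {y : E | ∃ (z : ℂ) (x : A.domain), IsEigenvector A z x ∧
    (x : E) = y}).topologicalClosure

/-- The spectrum of the self-adjoint operator `A` in the open set `J` is pure point: the range of
`1_J(A)` is contained in the pure point subspace. -/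
def IsPurePointOn (A : E →ₗ.[ℂ] E) (J : Set ℝ) : Prop :=
  spectralSubspace A J ≤ purePointSubspace A

end Abstract

/-- The Hilbert space `ℓ²(ℤ)`. -/
abbrev L2 : Type := lp (fun _ : ℤ => ℂ) 2

/-- The expression `ψ(n+1) + ψ(n-1) + V(n) ψ(n)`, on arbitrary sequences. -/
def expression (V : ℤ → ℝ) : (ℤ → ℂ) →ₗ[ℂ] (ℤ → ℂ) where
  toFun ψ := fun n => ψ (n + 1) + ψ (n - 1) + (V n : ℂ) * ψ n
  map_add' ψ φ := by
    funext n
    simp only [Pi.add_apply]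
    ring
  map_smul' c ψ := by
    funext n
    simp only [Pi.smul_apply, smul_eq_mul, RingHom.id_apply]
    ring

/-- The discrete Schrödinger operator `H = Δ + V` on `ℓ²(ℤ)` with an arbitrary real potential `V`,
on its natural domain, which consists of all `ψ` in `ℓ²(ℤ)` with `Hψ` in `ℓ²(ℤ)`. -/
def hamiltonian (V : ℤ → ℝ) : L2 →ₗ.[ℂ] L2 where
  domain :=
    { carrier := {ψ : L2 | Memℓp (expression V ψ) 2}
      add_mem' := by
        intro ψ φ hψ hφ
        simp only [Set.mem_ofPred_eq, lp.coeFn_add, map_add] at *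
        exact hψ.add hφ
      zero_mem' := by
        simp only [Set.mem_ofPred_eq, lp.coeFn_zero, map_zero]
        exact zero_memℓp
      smul_mem' := by
        intro c ψ hψ
        simp only [Set.mem_ofPred_eq, lp.coeFn_smul, map_smul] at *
        exact hψ.const_smul c }
  toFun :=
    { toFun := fun ψ => ⟨expression V (ψ : L2), ψ.2⟩
      map_add' := by
        intro ψ φ
        apply lp.ext
        exact (expression V).map_add _ _
      map_smul' := by
        intro c ψ
        apply lp.ext
        exact (expression V).map_smul c _ }

/-- The standard basis vector of `ℓ²(ℤ)` associated to the origin. -/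
def e0 : L2 := lp.single 2 (0 : ℤ) (1 : ℂ)

/-- The restriction of `ψ` to a set `S` of sites, extended by zero. -/
def restrictTo (S : Set ℤ) (ψ : L2) : L2 :=
  ⟨S.indicator (ψ : ℤ → ℂ), (lp.memℓp ψ).mono' fun n => norm_indicator_le_norm_self _ n⟩

/-- `ψ₊`: the restriction of `ψ` to the positive half-line. -/
def plusPart (ψ : L2) : L2 := restrictTo (Set.Ioi 0) ψ

/-- `ψ₋`: the restriction of `ψ` to the negative half-line. -/
def minusPart (ψ : L2) : L2 := restrictTo (Set.Iio 0) ψ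

/-- `δ(φ) = min {‖φ₊‖, ‖φ₋‖} / ‖φ‖`. -/
def delta (φ : L2) : ℝ := min ‖plusPart φ‖ ‖minusPart φ‖ / ‖φ‖

/-- `m = min {max {‖φ₋‖, ‖ψ₊‖}, max {‖φ₊‖, ‖ψ₋‖}}`. -/
def mConst (φ ψ : L2) : ℝ :=
  min (max ‖minusPart φ‖ ‖plusPart ψ‖) (max ‖plusPart φ‖ ‖minusPart ψ‖)

end Schrodinger

end

/-! Write `P` for `1_J(H)`. Since `P e₀ = 0`, every eigenvector with eigenvalue in `J` vanishes at
the origin, so cutting it there damages the eigenvalue equation only by a multiple of `e₀`: `(H - a)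
φ₊ = φ(1) e₀` and `(H - b) ψ₋ = -ψ(1) e₀`. Applying `P` removes `e₀`, and by simplicity `P φ₊` is a
multiple of `φ` and `P ψ₋` a multiple of `ψ`. Hence `f = φ₊ - P φ₊` and `g = ψ₋ - P ψ₋` are
orthogonal. In `w = ψ(1) φ₊ + φ(1) ψ₋` the `e₀` terms cancel, so `q = w - P w` satisfies `(H - a) q
= φ(1) (b - a) g`, while `‖q‖ ≥ |φ(1)| ‖g‖`. As `q` is orthogonal to the range of `P`, `H - a`
expands it by at least `dist(a, ∂J)`, which gives `dist(a, ∂J) ≤ |a - b|`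
(`le_abs_sub_of_eigenvectors`). This is stronger than the estimate with the factor `√(1 - m²)`.

Eigenvalues in `J` are therefore isolated. An interval of spectrum inside `J` would contain a dense
set of eigenvalues by pure pointness (`exists_eigenvalue_near`), which contradicts isolation.

The spectral input, `mul_norm_le_of_mem_orthogonal`, comes from the functional calculus of the
bounded normal operator `(A - i)⁻¹`. -/

namespace Schrodinger

/-! ### Resolvents of closed and of symmetric operators -/

section Resolvent

variable {E : Type*} [NormedAddCommGroup E] [InnerProductSpace ℂ E]

/-- `A - z` as a linear map on the domain of `A`. -/
def subScalar (A : E →ₗ.[ℂ] E) (z : ℂ) : A.domain →ₗ[ℂ] E :=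
  A.toFun - z • A.domain.subtype

theorem subScalar_apply (A : E →ₗ.[ℂ] E) (z : ℂ) (v : A.domain) :
    subScalar A z v = A v - z • (v : E) := rfl

/-- The range is that of the bounded map `(x, a) ↦ a - z • x` on the complete space `A.graph`, and
the lower bound makes this map antilipschitz for the graph norm. -/
theorem isClosed_range_subScalar [CompleteSpace E] {A : E →ₗ.[ℂ] E} {z : ℂ}
    (hA : IsClosed (A.graph : Set (E × E))) {c : ℝ} (hc : 0 < c)
    (hb : ∀ v : A.domain, c * ‖(v : E)‖ ≤ ‖A v - z • (v : E)‖) :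
    IsClosed (Set.range (subScalar A z)) := by
  have : CompleteSpace A.graph := hA.completeSpace_coe
  let L : A.graph →L[ℂ] E :=
    (ContinuousLinearMap.snd ℂ E E - z • ContinuousLinearMap.fst ℂ E E).comp A.graph.subtypeL
  have hL : ∀ p : A.graph, L p = p.1.2 - z • p.1.1 := fun p => rfl
  have hrange : Set.range (subScalar A z) = Set.range L := by
    ext y
    constructor
    · rintro ⟨v, rfl⟩
      exact ⟨⟨((v : E), A v), A.mem_graph v⟩, rfl⟩
    · rintro ⟨⟨⟨x, a⟩, hp⟩, rfl⟩
      obtain ⟨v, hv, hv'⟩ := (LinearPMap.mem_graph_iff A).1 hp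
      refine ⟨v, ?_⟩
      simp only at hv hv'
      rw [hL, subScalar_apply, hv, hv']
  have hbound : ∀ p : A.graph, ‖p‖ ≤ (Real.toNNReal (c⁻¹ + (1 + ‖z‖ * c⁻¹)) : ℝ) * ‖L p‖ := by
    rintro ⟨⟨x, a⟩, hp⟩
    obtain ⟨v, hv, hv'⟩ := (LinearPMap.mem_graph_iff A).1 hp
    simp only at hv hv'
    rw [hL, Real.coe_toNNReal _ (by positivity)]
    have h1 := hb v
    rw [hv, hv'] at h1
    have hx : ‖x‖ ≤ c⁻¹ * ‖a - z • x‖ := by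
      rw [inv_mul_eq_div, le_div_iff₀ hc]
      linarith
    have ha : ‖a‖ ≤ (1 + ‖z‖ * c⁻¹) * ‖a - z • x‖ := by
      calc ‖a‖ = ‖(a - z • x) + z • x‖ := by rw [sub_add_cancel]
        _ ≤ ‖a - z • x‖ + ‖z‖ * ‖x‖ := (norm_add_le _ _).trans_eq (by rw [norm_smul])
        _ ≤ ‖a - z • x‖ + ‖z‖ * (c⁻¹ * ‖a - z • x‖) := by gcongr
        _ = _ := by ring
    have h0 : 0 ≤ c⁻¹ * ‖a - z • x‖ := by positivity
    have h0' : 0 ≤ (1 + ‖z‖ * c⁻¹) * ‖a - z • x‖ := by positivity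
    change max ‖x‖ ‖a‖ ≤ _
    rw [add_mul]
    exact max_le (by linarith) (by linarith)
  rw [hrange]
  exact (AddMonoidHomClass.antilipschitz_of_bound L hbound).isClosed_range L.uniformContinuous

theorem exists_isResolventAt [CompleteSpace E] {A : E →ₗ.[ℂ] E} {z : ℂ}
    (hA : IsClosed (A.graph : Set (E × E))) {c : ℝ} (hc : 0 < c)
    (hb : ∀ v : A.domain, c * ‖(v : E)‖ ≤ ‖A v - z • (v : E)‖)
    (hd : ∀ y : E, (∀ v : A.domain, inner ℂ (A v - z • (v : E)) y = 0) → y = 0) :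
    ∃ R : E →L[ℂ] E, IsResolventAt A z R := by
  have hcl := isClosed_range_subScalar hA hc hb
  have hinj : Function.Injective (subScalar A z) := by
    rw [← LinearMap.ker_eq_bot, LinearMap.ker_eq_bot']
    intro v hv
    have h1 := hb v
    rw [← subScalar_apply, hv, norm_zero] at h1
    have h2 : ‖(v : E)‖ ≤ 0 := by
      by_contra! h
      nlinarith [mul_pos hc h]
    exact Subtype.ext (norm_le_zero_iff.1 h2)
  have hsurj : Function.Surjective (subScalar A z) := by
    rw [← LinearMap.range_eq_top]
    have h1 : (LinearMap.range (subScalar A z)).topologicalClosure = ⊤ := by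
      rw [Submodule.topologicalClosure_eq_top_iff, Submodule.eq_bot_iff]
      intro y hy
      exact hd y fun v => hy _ ⟨v, rfl⟩
    rwa [IsClosed.submodule_topologicalClosure_eq (by rwa [LinearMap.coe_range])] at h1
  let e := LinearEquiv.ofBijective (subScalar A z) ⟨hinj, hsurj⟩
  have he : ∀ v, e v = A v - z • (v : E) := fun v => rfl
  refine ⟨(A.domain.subtype ∘ₗ e.symm.toLinearMap).mkContinuous c⁻¹ ?_, ?_, ?_⟩
  · intro y
    have h1 := hb (e.symm y)
    rw [← he, e.apply_symm_apply] at h1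
    rw [inv_mul_eq_div, le_div_iff₀ hc]
    simpa [mul_comm] using h1
  · intro y
    refine ⟨e.symm y, rfl, ?_⟩
    rw [← he, e.apply_symm_apply]
  · intro v
    rw [← he]
    simp

/-- A symmetric operator for which both `A - i` and `A + i` have bounded inverses. -/
structure IsSelfAdjointOperator (A : E →ₗ.[ℂ] E) : Prop where
  symm : ∀ x y : A.domain, inner ℂ (A x) (y : E) = inner ℂ (x : E) (A y)
  resolvent_I : ∃ R : E →L[ℂ] E, IsResolventAt A Complex.I R
  resolvent_neg_I : ∃ R : E →L[ℂ] E, IsResolventAt A (-Complex.I) R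

theorem isResolventAt_unboundedResolvent {A : E →ₗ.[ℂ] E} {z : ℂ}
    (h : ∃ R : E →L[ℂ] E, IsResolventAt A z R) : IsResolventAt A z (unboundedResolvent A z) := by
  rw [unboundedResolvent, dif_pos h]
  exact h.choose_spec

/-- The eigenvalues of a symmetric operator are real. -/
theorem eigenvalue_im_eq_zero {A : E →ₗ.[ℂ] E}
    (hA : ∀ x y : A.domain, inner ℂ (A x) (y : E) = inner ℂ (x : E) (A y)) {z : ℂ} {x : A.domain}
    (hx : IsEigenvector A z x) : z.im = 0 := by
  have h := hA x x
  rw [hx.2, inner_smul_left, inner_smul_right] at h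
  have h2 := mul_right_cancel₀ (inner_self_ne_zero.2 hx.1) h
  exact Complex.conj_eq_iff_im.1 h2

/-- By symmetry `⟨x, A x⟩` is real, so only `z` contributes to the imaginary part of `⟨x, (A - z)
x⟩`. -/
theorem abs_im_mul_norm_le {A : E →ₗ.[ℂ] E}
    (hA : ∀ x y : A.domain, inner ℂ (A x) (y : E) = inner ℂ (x : E) (A y)) (z : ℂ) (x : A.domain) :
    |z.im| * ‖(x : E)‖ ≤ ‖A x - z • (x : E)‖ := by
  have h1 : (inner ℂ (x : E) (A x)).im = 0 := by
    rw [← Complex.conj_eq_iff_im, inner_conj_symm, hA]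
  have h2 : (inner ℂ (x : E) (A x - z • (x : E))).im = -(z.im * ‖(x : E)‖ ^ 2) := by
    rw [inner_sub_right, inner_smul_right, inner_self_eq_norm_sq_to_K, Complex.sub_im, h1]
    norm_cast
    simp [Complex.mul_im, -Complex.ofReal_pow]
  have h3 : |z.im| * ‖(x : E)‖ ^ 2 ≤ ‖(x : E)‖ * ‖A x - z • (x : E)‖ := by
    calc |z.im| * ‖(x : E)‖ ^ 2 = |(inner ℂ (x : E) (A x - z • (x : E))).im| := by
          rw [h2, abs_neg, abs_mul, abs_of_nonneg (sq_nonneg ‖(x : E)‖)]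
      _ ≤ _ := (Complex.abs_im_le_norm _).trans (norm_inner_le_norm _ _)
  rcases (norm_nonneg (x : E)).eq_or_lt with h | h
  · rw [← h, mul_zero]
    exact norm_nonneg _
  · nlinarith

/-- The function of `(A - i)⁻¹` which represents `f(A)`. -/
noncomputable def cayley (f : ℝ → ℝ) (w : ℂ) : ℂ :=
  if w = 0 then (0 : ℂ) else ((f (w⁻¹ + Complex.I).re : ℝ) : ℂ)

/-! ### Functional calculus through `W = (A - i)⁻¹` -/

variable [CompleteSpace E] {A : E →ₗ.[ℂ] E}

theorem functionOf_eq (A : E →ₗ.[ℂ] E) (f : ℝ → ℝ) :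
    functionOf A f = cfc (cayley f) (unboundedResolvent A Complex.I) := rfl

namespace IsSelfAdjointOperator

theorem star_resolvent (hA : IsSelfAdjointOperator A) :
    star (unboundedResolvent A Complex.I) = unboundedResolvent A (-Complex.I) := by
  have hp := isResolventAt_unboundedResolvent hA.resolvent_I
  have hm := isResolventAt_unboundedResolvent hA.resolvent_neg_I
  symm
  rw [ContinuousLinearMap.star_eq_adjoint, ContinuousLinearMap.eq_adjoint_iff]
  intro x y
  obtain ⟨u, hu, hu'⟩ := hm.1 x
  obtain ⟨v, hv, hv'⟩ := hp.1 y
  rw [← hu, ← hv]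
  conv_lhs => rw [← hv']
  conv_rhs => rw [← hu']
  rw [inner_sub_left, inner_sub_right, inner_smul_left, inner_smul_right, hA.symm]
  simp

/-- For `u = W x`, apply `(A + i)⁻¹` to `(A + i) u = x + 2i u`. Comparison with the reversed order
of factors yields normality of `W`. -/
theorem resolvent_identity (hA : IsSelfAdjointOperator A) :
    unboundedResolvent A Complex.I - star (unboundedResolvent A Complex.I) =
      (2 * Complex.I) • (star (unboundedResolvent A Complex.I) * unboundedResolvent A Complex.I) := by
  have hp := isResolventAt_unboundedResolvent hA.resolvent_I
  have hm := isResolventAt_unboundedResolvent hA.resolvent_neg_I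
  rw [hA.star_resolvent]
  ext x
  obtain ⟨u, hu, hu'⟩ := hp.1 x
  have h := hm.2 u
  have h2 : A u - -Complex.I • (u : E) = x + (2 * Complex.I) • (u : E) := by
    rw [← hu']
    module
  rw [h2, map_add, map_smul, hu] at h
  simp only [sub_apply, smul_apply, mul_apply_eq_comp]
  rw [sub_eq_iff_eq_add', h]

theorem resolvent_identity' (hA : IsSelfAdjointOperator A) :
    unboundedResolvent A Complex.I - star (unboundedResolvent A Complex.I) =
      (2 * Complex.I) • (unboundedResolvent A Complex.I * star (unboundedResolvent A Complex.I)) := by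
  have hp := isResolventAt_unboundedResolvent hA.resolvent_I
  have hm := isResolventAt_unboundedResolvent hA.resolvent_neg_I
  rw [hA.star_resolvent]
  ext x
  obtain ⟨u, hu, hu'⟩ := hm.1 x
  have h := hp.2 u
  have h2 : A u - Complex.I • (u : E) = x - (2 * Complex.I) • (u : E) := by
    rw [← hu']
    module
  rw [h2, map_sub, map_smul, hu] at h
  simp only [sub_apply, smul_apply, mul_apply_eq_comp]
  rw [sub_eq_iff_eq_add] at h ⊢
  rw [h]
  abel

theorem isStarNormal_resolvent (hA : IsSelfAdjointOperator A) :
    IsStarNormal (unboundedResolvent A Complex.I) := by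
  refine ⟨?_⟩
  have h := hA.resolvent_identity.symm.trans hA.resolvent_identity'
  exact smul_right_injective _ (by simp) h

/-- By spectral mapping the resolvent identity becomes `Im w = |w|²`, so `Im w⁻¹ = -1`. -/
theorem im_inv_of_mem_spectrum (hA : IsSelfAdjointOperator A) {w : ℂ}
    (hw : w ∈ spectrum ℂ (unboundedResolvent A Complex.I)) (h0 : w ≠ 0) :
    (w⁻¹ + Complex.I).im = 0 := by
  have hn := hA.isStarNormal_resolvent
  set W := unboundedResolvent A Complex.I with hW
  have h1 : cfc (fun w : ℂ => w - star w - (2 * Complex.I) * (star w * w)) W = 0 := by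
    rw [cfc_sub _ _ W, cfc_sub _ _ W, cfc_const_mul _ _ W, cfc_mul _ _ W, cfc_star_id W,
      cfc_id' ℂ W, hA.resolvent_identity, sub_self]
  have h2 : w - star w - (2 * Complex.I) * (star w * w) ∈ spectrum ℂ (0 : E →L[ℂ] E) := by
    rw [← h1, cfc_map_spectrum (R := ℂ) (fun w : ℂ => w - star w - (2 * Complex.I) * (star w * w)) W]
    exact ⟨w, hw, rfl⟩
  have : Nontrivial (E →L[ℂ] E) := by
    by_contra h
    rw [not_nontrivial_iff_subsingleton] at h
    rw [spectrum.of_subsingleton] at hw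
    exact hw
  rw [spectrum.zero_eq, Set.mem_singleton_iff] at h2
  have h3 : Complex.normSq w ≠ 0 := by simpa using h0
  have h4 := congrArg Complex.im h2
  simp at h4
  rw [Complex.add_im, Complex.inv_im, Complex.I_im]
  rw [Complex.normSq_apply] at h3 ⊢
  rw [← sub_eq_zero.1 (show w.im - (w.re * w.re + w.im * w.im) = 0 by linarith)] at h3 ⊢
  rw [neg_div, div_self h3, neg_add_cancel]

theorem continuousOn_cayley (hA : IsSelfAdjointOperator A) {f : ℝ → ℝ} (hf : Continuous f)
    (hs : HasCompactSupport f) :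
    ContinuousOn (cayley f) (spectrum ℂ (unboundedResolvent A Complex.I)) := by
  intro w hw
  by_cases h0 : w = 0
  · subst h0
    obtain ⟨R, hR⟩ := hs.isBounded.subset_closedBall (0 : ℝ)
    have h1 : ∀ᶠ v in 𝓝[spectrum ℂ (unboundedResolvent A Complex.I)] (0 : ℂ), cayley f v = 0 := by
      rw [eventually_nhdsWithin_iff]
      -- On this ball `|v⁻¹| > |R| + 1`, so the real number `v⁻¹ + i` has modulus above `|R|` and
      -- lies off the support of `f`.
      filter_upwards [Metric.ball_mem_nhds (0 : ℂ) (show 0 < (|R| + 1)⁻¹ by positivity)] with v hv hv'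
      rw [cayley]
      split_ifs with hv0
      · rfl
      · rw [Complex.ofReal_eq_zero]
        by_contra hne
        have h2 := hR (subset_tsupport f hne)
        rw [mem_closedBall_zero_iff, Real.norm_eq_abs] at h2
        have h3 := hA.im_inv_of_mem_spectrum hv' hv0
        rw [mem_ball_zero_iff] at hv
        have h4 : ‖v⁻¹ + Complex.I‖ = |(v⁻¹ + Complex.I).re| :=
          (Complex.abs_re_eq_norm.2 h3).symm
        have h5 : |R| + 1 < ‖v⁻¹‖ := by
          rw [norm_inv]
          exact (lt_inv_comm₀ (norm_pos_iff.2 hv0) (by positivity)).1 hv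
        have h6 := norm_sub_le (v⁻¹ + Complex.I) Complex.I
        rw [add_sub_cancel_right, Complex.norm_I, h4] at h6
        linarith [le_abs_self R]
    have h2 : cayley f 0 = 0 := if_pos rfl
    exact ContinuousWithinAt.congr_of_eventuallyEq continuousWithinAt_const h1 h2
  · have h1 : ∀ᶠ v in 𝓝 w, cayley f v = ((f (v⁻¹ + Complex.I).re : ℝ) : ℂ) := by
      filter_upwards [isOpen_ne.mem_nhds h0] with v hv
      exact if_neg hv
    refine ContinuousAt.continuousWithinAt (ContinuousAt.congr ?_ (h1.mono fun v hv => hv.symm))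
    refine Complex.continuous_ofReal.continuousAt.comp (hf.continuousAt.comp ?_)
    exact Complex.continuous_re.continuousAt.comp ((continuousAt_inv₀ h0).add continuousAt_const)

theorem isSelfAdjoint_functionOf (A : E →ₗ.[ℂ] E) (f : ℝ → ℝ) :
    IsSelfAdjoint (functionOf A f) := by
  rw [IsSelfAdjoint, functionOf_eq, ← cfc_star]
  congr 1
  funext w
  rw [cayley]
  split_ifs
  · simp
  · exact Complex.conj_ofReal _

theorem commute_functionOf (hA : IsSelfAdjointOperator A) (f : ℝ → ℝ) :
    Commute (functionOf A f) (unboundedResolvent A Complex.I) := by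
  have hn := hA.isStarNormal_resolvent
  have h := cfc_commute_cfc (cayley f) id (unboundedResolvent A Complex.I)
  rwa [cfc_id ℂ (unboundedResolvent A Complex.I)] at h

end IsSelfAdjointOperator

/-- The continuous functional calculus of a normal operator on eigenvectors. -/
theorem cfc_apply_eigenvector {W : E →L[ℂ] E} (hW : IsStarNormal W) {w : ℂ} {x : E} (hx : x ≠ 0)
    (h : W x = w • x) {g : ℂ → ℂ} (hg : ContinuousOn g (spectrum ℂ W)) :
    cfc g W x = g w • x := by
  have hw : w ∈ spectrum ℂ W := by
    intro hu
    obtain ⟨u, hu⟩ := hu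
    have h1 : (u : E →L[ℂ] E) x = 0 := by
      rw [hu]
      simp [h, Algebra.algebraMap_eq_smul_one]
    have h2 : ((u⁻¹ : (E →L[ℂ] E)ˣ) : E →L[ℂ] E) ((u : E →L[ℂ] E) x) = x := by
      rw [← mul_apply_eq_comp, Units.inv_mul]
      rfl
    rw [h1, map_zero] at h2
    exact hx h2.symm
  -- `W - w` is normal, so its kernel equals that of its adjoint.
  have hs : star W x = star w • x := by
    have hn : IsStarNormal (W - w • (1 : E →L[ℂ] E)) := by
      refine ⟨?_⟩
      have := hW.star_comm_self
      rw [star_sub, star_smul, star_one]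
      refine ((this.sub_left ?_).sub_right (Commute.sub_left ?_ ?_))
      · exact (Commute.one_left W).smul_left _
      · exact (Commute.one_right _).smul_right _
      · exact ((Commute.one_right _).smul_right _)
    have h1 : (W - w • (1 : E →L[ℂ] E)) x = 0 := by simp [h]
    have h2 : star (W - w • (1 : E →L[ℂ] E)) x = 0 :=
      (ContinuousLinearMap.IsStarNormal.adjoint_apply_eq_zero_iff hn x).2 h1
    rw [star_sub, star_smul, star_one] at h2
    simpa [sub_eq_zero] using h2
  -- Stone–Weierstrass: polynomials in `w` and its conjugate are dense.
  have hind : ∀ k : C(spectrum ℂ W, ℂ), cfcHom hW k x = k ⟨w, hw⟩ • x := by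
    intro k
    induction k using ContinuousMap.induction_on_of_compact with
    | const r =>
      have : ContinuousMap.const (spectrum ℂ W) r = algebraMap ℂ _ r := rfl
      rw [this, AlgHomClass.commutes]
      simp [Algebra.algebraMap_eq_smul_one]
    | id => rw [cfcHom_id hW]; exact h
    | star_id => rw [map_star, cfcHom_id hW]; exact hs
    | add f g hf hg => rw [map_add, add_apply, hf, hg, ContinuousMap.add_apply, add_smul]
    | mul f g hf hg =>
      rw [map_mul, mul_apply_eq_comp, hg, map_smul, hf, ContinuousMap.mul_apply,
        smul_smul, mul_comm]
    | frequently f hf =>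
      have hcl : IsClosed {k : C(spectrum ℂ W, ℂ) | cfcHom hW k x = k ⟨w, hw⟩ • x} := by
        refine isClosed_eq ?_ ?_
        · exact ((ContinuousLinearMap.apply ℂ E x).continuous.comp (cfcHom_continuous hW))
        · exact (ContinuousEvalConst.continuous_eval_const _).smul continuous_const
      exact hcl.mem_of_frequently_of_tendsto hf Filter.tendsto_id
  rw [cfc_apply g W hW hg, hind]
  rfl

end Resolvent

/-- The truncated parabola `max (0, r² - (t - a)²)`, which is positive exactly on `(a - r, a + r)`. -/
noncomputable def parabola (a r t : ℝ) : ℝ := max 0 (r ^ 2 - (t - a) ^ 2)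

theorem continuous_parabola (a r : ℝ) : Continuous (parabola a r) := by
  unfold parabola
  fun_prop

theorem tsupport_parabola_subset (a : ℝ) {r : ℝ} (hr : 0 < r) :
    tsupport (parabola a r) ⊆ Set.Icc (a - r) (a + r) := by
  refine closure_minimal ?_ isClosed_Icc
  intro t ht
  by_contra h
  apply ht
  rw [parabola, max_eq_left_iff, sub_nonpos, sq_le_sq, abs_of_pos hr, le_abs]
  rw [Set.mem_Icc, not_and_or, not_le, not_le] at h
  rcases h with h | h
  · right; linarith
  · left; linarith

theorem hasCompactSupport_parabola (a : ℝ) {r : ℝ} (hr : 0 < r) :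
    HasCompactSupport (parabola a r) :=
  isCompact_Icc.of_isClosed_subset (isClosed_tsupport _) (tsupport_parabola_subset a hr)

/-! ### Spectral subspaces and the spectral gap -/

section SpectralSubspace

open scoped ComplexOrder

variable {E : Type*} [NormedAddCommGroup E] [InnerProductSpace ℂ E] [CompleteSpace E]
  {A : E →ₗ.[ℂ] E}

theorem functionOf_mem_spectralSubspace (A : E →ₗ.[ℂ] E) {J : Set ℝ} {f : ℝ → ℝ}
    (hf : Continuous f) (hs : HasCompactSupport f) (hJ : tsupport f ⊆ J) (x : E) :
    functionOf A f x ∈ spectralSubspace A J :=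
  Submodule.le_topologicalClosure _ (Submodule.subset_span ⟨f, hf, hs, hJ, x, rfl⟩)

theorem spectralSubspace_mono (A : E →ₗ.[ℂ] E) {J K : Set ℝ} (h : J ⊆ K) :
    spectralSubspace A J ≤ spectralSubspace A K := by
  refine Submodule.topologicalClosure_mono (Submodule.span_mono ?_)
  rintro y ⟨f, hf, hs, hJ, hy⟩
  exact ⟨f, hf, hs, hJ.trans h, hy⟩

/-- The orthogonal complement of the range of `1_J(A)` is the common kernel of all `f(A)`, `f`
supported in `J`. -/
theorem mem_spectralSubspace_orthogonal_iff {J : Set ℝ} {x : E} :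
    x ∈ (spectralSubspace A J)ᗮ ↔ ∀ f : ℝ → ℝ, Continuous f → HasCompactSupport f →
      tsupport f ⊆ J → functionOf A f x = 0 := by
  have hsa : ∀ (f : ℝ → ℝ) (y z : E),
      inner ℂ (functionOf A f y) z = inner ℂ y (functionOf A f z) := by
    intro f y z
    have h := IsSelfAdjointOperator.isSelfAdjoint_functionOf A f
    rw [ContinuousLinearMap.isSelfAdjoint_iff'] at h
    conv_rhs => rw [← h]
    rw [ContinuousLinearMap.adjoint_inner_right]
  constructor
  · intro h f hf hs hJ
    have h1 := h _ (functionOf_mem_spectralSubspace A hf hs hJ (functionOf A f x))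
    rw [hsa] at h1
    exact inner_self_eq_zero.1 h1
  · intro h
    rw [spectralSubspace, Submodule.orthogonal_closure, Submodule.mem_orthogonal]
    intro u hu
    induction hu using Submodule.span_induction with
    | mem u hu =>
      obtain ⟨f, hf, hs, hJ, y, rfl⟩ := hu
      rw [hsa, h f hf hs hJ, inner_zero_right]
    | zero => exact inner_zero_left _
    | add u v _ _ hu hv => rw [inner_add_left, hu, hv, add_zero]
    | smul c u _ hu => rw [inner_smul_left, hu, mul_zero]

namespace IsSelfAdjointOperator

theorem functionOf_eigenvector (hA : IsSelfAdjointOperator A) {f : ℝ → ℝ} (hf : Continuous f)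
    (hs : HasCompactSupport f) {a : ℝ} {x : A.domain} (hx : IsEigenvector A (a : ℂ) x) :
    functionOf A f x = (f a : ℂ) • (x : E) := by
  have hne : (a : ℂ) - Complex.I ≠ 0 := by
    intro h
    have := congrArg Complex.im h
    simp at this
  have hW : unboundedResolvent A Complex.I x = ((a : ℂ) - Complex.I)⁻¹ • (x : E) := by
    have h := (isResolventAt_unboundedResolvent hA.resolvent_I).2 x
    rw [hx.2, ← sub_smul, map_smul] at h
    rw [eq_inv_smul_iff₀ hne, h]
  rw [functionOf_eq, cfc_apply_eigenvector hA.isStarNormal_resolvent hx.1 hW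
    (hA.continuousOn_cayley hf hs), cayley, if_neg (inv_ne_zero hne)]
  simp

theorem eigenvector_mem_spectralSubspace (hA : IsSelfAdjointOperator A) {J : Set ℝ}
    (hJ : IsOpen J) {a : ℝ} (ha : a ∈ J) {x : A.domain} (hx : IsEigenvector A (a : ℂ) x) :
    (x : E) ∈ spectralSubspace A J := by
  obtain ⟨r, hr, hrJ⟩ := Metric.nhds_basis_closedBall.mem_iff.1 (hJ.mem_nhds ha)
  rw [Real.closedBall_eq_Icc] at hrJ
  have h := hA.functionOf_eigenvector (continuous_parabola a r) (hasCompactSupport_parabola a hr) hx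
  have hne : ((parabola a r a : ℝ) : ℂ) ≠ 0 := by
    rw [Complex.ofReal_ne_zero, parabola, sub_self]
    exact (lt_max_of_lt_right (by simpa using pow_pos hr 2)).ne'
  rw [← inv_smul_eq_iff₀ hne] at h
  rw [← h]
  exact Submodule.smul_mem _ _ (functionOf_mem_spectralSubspace A (continuous_parabola a r)
    (hasCompactSupport_parabola a hr) ((tsupport_parabola_subset a hr).trans hrJ) _)

/-- The scalar inequality `(t - a)² - r² + parabola a r t ≥ 0`, multiplied by `|w|²` with `w = (t -
i)⁻¹`, becomes positivity of a bounded operator. It is evaluated at `(A - i) v`, where the parabola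
term vanishes. -/
theorem mul_norm_le_of_functionOf_eq_zero (hA : IsSelfAdjointOperator A) {a r : ℝ} (hr : 0 < r)
    {v : A.domain} (hv : functionOf A (parabola a r) v = 0) :
    r * ‖(v : E)‖ ≤ ‖A v - (a : ℂ) • (v : E)‖ := by
  have hn := hA.isStarNormal_resolvent
  have hF := hA.continuousOn_cayley (continuous_parabola a r) (hasCompactSupport_parabola a hr)
  have hWv := (isResolventAt_unboundedResolvent hA.resolvent_I).2 v
  have hFW := functionOf_eq A (parabola a r)
  have himW := fun w => hA.im_inv_of_mem_spectrum (w := w)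
  set W := unboundedResolvent A Complex.I
  set F := functionOf A (parabola a r)
  set x := A v - Complex.I • (v : E) with hx
  -- This is `(A - a) (A - i)⁻¹`.
  let X : E →L[ℂ] E := 1 + (Complex.I - a) • W
  have hpos : 0 ≤ star X * X - ((r : ℂ) ^ 2) • (star W * W) + star W * (F * W) := by
    have h1 : cfc (fun w : ℂ => star (1 + (Complex.I - a) * w) * (1 + (Complex.I - a) * w)
        - (r : ℂ) ^ 2 * (star w * w) + star w * (cayley (parabola a r) w * w)) W =
        star X * X - ((r : ℂ) ^ 2) • (star W * W) + star W * (F * W) := by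
      have hX : cfc (fun w : ℂ => 1 + (Complex.I - a) * w) W = X := by
        rw [cfc_const_add (1 : ℂ) _ W, cfc_const_mul _ _ W, cfc_id' ℂ W, map_one]
      rw [cfc_add W _ _, cfc_sub _ _ W, cfc_const_mul _ _ W, cfc_mul _ _ W, cfc_mul _ _ W,
        cfc_mul _ _ W, cfc_mul _ _ W, cfc_star, cfc_star_id W, cfc_id' ℂ W, hX, hFW]
    rw [← h1]
    refine cfc_nonneg fun w hw => ?_
    by_cases h0 : w = 0
    · simp [h0]
    · have him := himW w hw h0
      set t := (w⁻¹ + Complex.I).re with ht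
      have htw : w⁻¹ + Complex.I = t := Complex.ext rfl (by simpa using him)
      have hcay : cayley (parabola a r) w = (parabola a r t : ℝ) := if_neg h0
      have h2 : 1 + (Complex.I - a) * w = ((t - a : ℝ) : ℂ) * w := by
        push_cast
        rw [← htw]
        field_simp
        ring
      have h3 : star (1 + (Complex.I - a) * w) * (1 + (Complex.I - a) * w)
        - (r : ℂ) ^ 2 * (star w * w) + star w * (cayley (parabola a r) w * w) =
          ((((t - a) ^ 2 - r ^ 2 + parabola a r t) * Complex.normSq w : ℝ) : ℂ) := by
        rw [hcay, h2, star_mul, Complex.star_def, Complex.conj_ofReal]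
        push_cast
        rw [Complex.normSq_eq_conj_mul_self]
        ring
      rw [h3, Complex.zero_le_real]
      refine mul_nonneg ?_ (Complex.normSq_nonneg _)
      have : r ^ 2 - (t - a) ^ 2 ≤ parabola a r t := le_max_right _ _
      linarith
  have h4 := ((ContinuousLinearMap.nonneg_iff_isPositive _).1 hpos).inner_nonneg_left x
  have hXx : X x = A v - (a : ℂ) • (v : E) := by
    change x + (Complex.I - a) • W x = _
    rw [hWv, hx]
    module
  have h5 : (star X * X - ((r : ℂ) ^ 2) • (star W * W) + star W * (F * W)) x =
      star X (X x) - ((r : ℂ) ^ 2) • star W (W x) := by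
    have : F (W x) = 0 := by rw [hWv, hv]
    simp [this]
  rw [h5, inner_sub_left, inner_smul_left, ContinuousLinearMap.star_eq_adjoint,
    ContinuousLinearMap.star_eq_adjoint, ContinuousLinearMap.adjoint_inner_left,
    ContinuousLinearMap.adjoint_inner_left, hXx, hWv, inner_self_eq_norm_sq_to_K,
    inner_self_eq_norm_sq_to_K] at h4
  have h6 : 0 ≤ ‖A v - (a : ℂ) • (v : E)‖ ^ 2 - r ^ 2 * ‖(v : E)‖ ^ 2 := by
    rw [← Complex.zero_le_real]
    simpa using h4
  rw [← mul_pow, sub_nonneg] at h6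
  exact (sq_le_sq₀ (by positivity) (norm_nonneg _)).1 h6

/-- On the orthogonal complement of the range of `1_J(A)`, the operator `A - a` is bounded below by
the distance of `a` to the complement of `J`. -/
theorem mul_norm_le_of_mem_orthogonal (hA : IsSelfAdjointOperator A) {J : Set ℝ} {a r : ℝ}
    (hJ : Set.Ioo (a - r) (a + r) ⊆ J) {v : A.domain} (hv : (v : E) ∈ (spectralSubspace A J)ᗮ) :
    r * ‖(v : E)‖ ≤ ‖A v - (a : ℂ) • (v : E)‖ := by
  rcases (norm_nonneg (v : E)).eq_or_lt with h0 | h0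
  · rw [← h0, mul_zero]
    exact norm_nonneg _
  rw [← le_div_iff₀ h0]
  -- The support of a parabola of radius `r` may reach the endpoints, hence radii `s < r`.
  refine le_of_forall_lt_imp_le_of_dense fun s hs => ?_
  rw [le_div_iff₀ h0]
  rcases le_or_gt s 0 with hs0 | hs0
  · exact (mul_nonpos_of_nonpos_of_nonneg hs0 h0.le).trans (norm_nonneg _)
  · refine hA.mul_norm_le_of_functionOf_eq_zero hs0
      (mem_spectralSubspace_orthogonal_iff.1 hv _ (continuous_parabola a s)
      (hasCompactSupport_parabola a hs0) ((tsupport_parabola_subset a hs0).trans ?_))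
    exact (Set.Icc_subset_Ioo (by linarith) (by linarith)).trans hJ

/-- The resolvent commutes with the spectral projector. -/
theorem spectralProjector_resolvent (hA : IsSelfAdjointOperator A) (J : Set ℝ) (x : E) :
    spectralProjector A J (unboundedResolvent A Complex.I x) =
      unboundedResolvent A Complex.I (spectralProjector A J x) := by
  have hcomm : ∀ f y, functionOf A f (unboundedResolvent A Complex.I y) =
      unboundedResolvent A Complex.I (functionOf A f y) := fun f y =>
    DFunLike.congr_fun (hA.commute_functionOf f) y
  -- The resolvent commutes with every `f(A)`, so it preserves both the subspace and its orthogonal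
  -- complement.
  refine Submodule.eq_starProjection_of_mem_orthogonal ?_ ?_
  · have hle : spectralSubspace A J ≤
        (spectralSubspace A J).comap (unboundedResolvent A Complex.I).toLinearMap := by
      refine Submodule.topologicalClosure_minimal _ (Submodule.span_le.2 ?_) ?_
      · rintro y ⟨f, hf, hs, hJ, z, rfl⟩
        change unboundedResolvent A Complex.I (functionOf A f z) ∈ spectralSubspace A J
        rw [← hcomm]
        exact functionOf_mem_spectralSubspace A hf hs hJ _
      · exact (Submodule.isClosed_topologicalClosure _).preimage
          (unboundedResolvent A Complex.I).continuous
    exact hle (Submodule.starProjection_apply_mem _ x)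
  · rw [← map_sub, mem_spectralSubspace_orthogonal_iff]
    intro f hf hs hJ
    have h : functionOf A f (x - spectralProjector A J x) = 0 :=
      mem_spectralSubspace_orthogonal_iff.1 (Submodule.sub_starProjection_mem_orthogonal x) f hf hs hJ
    rw [hcomm, h, map_zero]

/-- The spectral projector preserves the domain of `A` and commutes with `A`. -/
theorem exists_spectralProjector_eq (hA : IsSelfAdjointOperator A) (J : Set ℝ) (u : A.domain) :
    ∃ v : A.domain, (v : E) = spectralProjector A J u ∧ A v = spectralProjector A J (A u) := by
  have hW := isResolventAt_unboundedResolvent hA.resolvent_I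
  obtain ⟨v, hv, hv'⟩ := hW.1 (spectralProjector A J (A u - Complex.I • (u : E)))
  have h : (v : E) = spectralProjector A J u := by
    rw [hv, ← hA.spectralProjector_resolvent, hW.2]
  refine ⟨v, h, ?_⟩
  rw [map_sub, map_smul, ← h] at hv'
  exact sub_left_inj.1 hv'

/-- If `J` contains no eigenvalue and the spectrum in `J` is pure point, then `1_J(A) = 0`. -/
theorem spectralSubspace_orthogonal_eq_top (hA : IsSelfAdjointOperator A) {J : Set ℝ}
    (hpp : IsPurePointOn A J) (hJ : ∀ a ∈ J, ¬ IsEigenvalue A (a : ℂ)) :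
    (spectralSubspace A J)ᗮ = ⊤ := by
  have hle : purePointSubspace A ≤ (spectralSubspace A J)ᗮ := by
    refine Submodule.topologicalClosure_minimal _ (Submodule.span_le.2 ?_)
      (Submodule.isClosed_orthogonal _)
    rintro y ⟨z, x, hx, rfl⟩
    have hz : z = (z.re : ℂ) :=
      Complex.ext rfl (by simpa using eigenvalue_im_eq_zero hA.symm hx)
    rw [hz] at hx
    rw [SetLike.mem_coe, mem_spectralSubspace_orthogonal_iff]
    intro f hf hs hfJ
    have h0 : f z.re = 0 :=
      image_eq_zero_of_notMem_tsupport fun hmem => hJ _ (hfJ hmem) ⟨x, hx⟩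
    rw [hA.functionOf_eigenvector hf hs hx, h0, Complex.ofReal_zero, zero_smul]
  have hbot : spectralSubspace A J = ⊥ := by
    rw [eq_bot_iff, ← Submodule.inf_orthogonal_eq_bot (spectralSubspace A J)]
    exact le_inf le_rfl (hpp.trans hle)
  rw [hbot, Submodule.bot_orthogonal_eq_top]

/-- Without such an eigenvalue the spectral projector of the interval is `0`, so `A - a` is bounded
below by `r` on its whole domain. By `hker` its range is dense, so `a` is in the resolvent set. -/
theorem exists_eigenvalue_of_mem_spectrum (hA : IsSelfAdjointOperator A)
    (hcl : IsClosed (A.graph : Set (E × E))) {J : Set ℝ} (hpp : IsPurePointOn A J) {a r : ℝ}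
    (hr : 0 < r) (hJ : Set.Ioo (a - r) (a + r) ⊆ J) (ha : (a : ℂ) ∈ unboundedSpectrum A)
    (hker : ∀ y : E, (∀ v : A.domain, inner ℂ (A v - (a : ℂ) • (v : E)) y = 0) →
      ∃ v : A.domain, (v : E) = y ∧ A v = (a : ℂ) • y) :
    ∃ b ∈ Set.Ioo (a - r) (a + r), IsEigenvalue A (b : ℂ) := by
  by_contra! h
  have htop := hA.spectralSubspace_orthogonal_eq_top (J := Set.Ioo (a - r) (a + r))
    ((spectralSubspace_mono A hJ).trans hpp) h
  have hb : ∀ v : A.domain, r * ‖(v : E)‖ ≤ ‖A v - (a : ℂ) • (v : E)‖ := fun v =>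
    hA.mul_norm_le_of_mem_orthogonal (J := Set.Ioo (a - r) (a + r)) le_rfl
      (htop ▸ Submodule.mem_top)
  refine ha (exists_isResolventAt hcl hr hb fun y hy => ?_)
  obtain ⟨v, rfl, hv⟩ := hker y hy
  by_contra hne
  exact h a ⟨by linarith, by linarith⟩ ⟨v, hne, hv⟩

end IsSelfAdjointOperator

end SpectralSubspace

/-! ### Self-adjointness of `H` and half-line truncations -/

section Hamiltonian

variable {V : ℤ → ℝ}

theorem hamiltonian_apply (ψ : (hamiltonian V).domain) (n : ℤ) :
    (hamiltonian V ψ : L2) n =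
      (ψ : L2) (n + 1) + (ψ : L2) (n - 1) + (V n : ℂ) * (ψ : L2) n := rfl

theorem exists_hamiltonian_eq {u η : L2}
    (h : ∀ n : ℤ, η n = u (n + 1) + u (n - 1) + (V n : ℂ) * u n) :
    ∃ v : (hamiltonian V).domain, (v : L2) = u ∧ hamiltonian V v = η := by
  have he : expression V u = (η : ℤ → ℂ) := funext fun n => (h n).symm
  have hu : u ∈ (hamiltonian V).domain := by
    change Memℓp (expression V u) 2
    rw [he]
    exact lp.memℓp η
  exact ⟨⟨u, hu⟩, rfl, lp.ext he⟩

theorem continuous_coord (n : ℤ) : Continuous fun u : L2 => u n :=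
  (lp.evalCLM ℂ (fun _ : ℤ => ℂ) 2 n).continuous

theorem isClosed_graph_hamiltonian (V : ℤ → ℝ) :
    IsClosed ((hamiltonian V).graph : Set (L2 × L2)) := by
  have h : ((hamiltonian V).graph : Set (L2 × L2)) =
      ⋂ n : ℤ, {p : L2 × L2 | p.2 n = p.1 (n + 1) + p.1 (n - 1) + (V n : ℂ) * p.1 n} := by
    ext ⟨u, η⟩
    simp only [SetLike.mem_coe, LinearPMap.mem_graph_iff, Set.mem_iInter, Set.mem_ofPred_eq]
    constructor
    · rintro ⟨v, rfl, rfl⟩ n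
      rfl
    · exact exists_hamiltonian_eq
  rw [h]
  refine isClosed_iInter fun n => isClosed_eq ((continuous_coord n).comp continuous_snd) ?_
  exact (((continuous_coord _).comp continuous_fst).add
    ((continuous_coord _).comp continuous_fst)).add
    (continuous_const.mul ((continuous_coord n).comp continuous_fst))

theorem summable_inner_shift (u v : L2) :
    Summable fun n : ℤ => inner ℂ (u (n + 1)) (v n) := by
  have hu := (lp.memℓp u).summable (by norm_num)
  have hv := (lp.memℓp v).summable (by norm_num)
  have hu' := ((Equiv.addRight (1 : ℤ)).summable_iff
    (f := fun n => ‖(u : ℤ → ℂ) n‖ ^ (2 : ℝ≥0∞).toReal)).2 hu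
  refine Summable.of_norm_bounded (hu'.add hv) fun n => ?_
  refine (norm_inner_le_norm _ _).trans ?_
  simp only [Function.comp_apply, Equiv.coe_addRight, ENNReal.toReal_ofNat, Real.rpow_ofNat]
  nlinarith [sq_nonneg (‖u (n + 1)‖ - ‖v n‖), sq_nonneg ‖u (n + 1)‖, sq_nonneg ‖v n‖]

/-- Summation by parts: the Wronskian of two `ℓ²` sequences is summable. -/
theorem hasSum_wronskian_sub (u v : L2) :
    HasSum (fun n : ℤ => (inner ℂ (u (n + 1)) (v n) - star (inner ℂ (v (n + 1)) (u n))) -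
      (inner ℂ (u n) (v (n - 1)) - star (inner ℂ (v n) (u (n - 1))))) 0 := by
  have hD := ((summable_inner_shift u v).sub (summable_inner_shift v u).star).hasSum
  have h := hD.sub ((Equiv.subRight (1 : ℤ)).hasSum_iff.2 hD)
  simpa only [sub_self, Function.comp_def, Equiv.subRight_apply, sub_add_cancel] using h

theorem hasSum_inner_apply (u v : L2) :
    HasSum (fun n : ℤ => inner ℂ (u n) (v n)) (inner ℂ u v) :=
  lp.hasSum_inner u v

/-- The real potential cancels termwise, leaving differences of consecutive Wronskians. These are
summable for `ℓ²` sequences, so no boundary term survives, whatever `V` is. -/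
theorem hamiltonian_symm (φ ψ : (hamiltonian V).domain) :
    inner ℂ (hamiltonian V φ) (ψ : L2) = inner ℂ (φ : L2) (hamiltonian V ψ) := by
  have h1 := (hasSum_inner_apply (hamiltonian V φ) (ψ : L2)).sub
    (hasSum_inner_apply (φ : L2) (hamiltonian V ψ))
  have e : ∀ n : ℤ, inner ℂ ((hamiltonian V φ : L2) n) ((ψ : L2) n) -
      inner ℂ ((φ : L2) n) ((hamiltonian V ψ : L2) n) =
      (inner ℂ ((φ : L2) (n + 1)) ((ψ : L2) n) - star (inner ℂ ((ψ : L2) (n + 1)) ((φ : L2) n))) -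
      (inner ℂ ((φ : L2) n) ((ψ : L2) (n - 1)) - star (inner ℂ ((ψ : L2) n) ((φ : L2) (n - 1)))) := by
    intro n
    simp only [hamiltonian_apply, RCLike.inner_apply, map_add, map_mul, Complex.conj_ofReal,
      Complex.star_def, Complex.conj_conj]
    ring
  rw [funext e] at h1
  exact sub_eq_zero.1 (h1.unique (hasSum_wronskian_sub (φ : L2) (ψ : L2)))

/-- A vector orthogonal to the range of `H - z` is in the kernel of `H - z̄`. -/
theorem exists_eigenvector_of_orthogonal {z : ℂ} {y : L2}
    (h : ∀ v : (hamiltonian V).domain, inner ℂ (hamiltonian V v - z • (v : L2)) y = 0) :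
    ∃ v : (hamiltonian V).domain, (v : L2) = y ∧ hamiltonian V v = (starRingEnd ℂ z) • y := by
  refine exists_hamiltonian_eq fun n => ?_
  let s : ℤ → L2 := fun k => lp.single 2 k (1 : ℂ)
  have hs : ∀ k m : ℤ, s k m = if m = k then 1 else 0 := by
    intro k m
    simp [s, Pi.single_apply]
  -- Testing against the basis vector at `n` reads off the equation at site `n`.
  obtain ⟨v, hv, hv'⟩ := exists_hamiltonian_eq (V := V) (u := s n)
    (η := s (n - 1) + s (n + 1) + (V n : ℂ) • s n) (by
      intro m
      simp only [lp.coeFn_add, lp.coeFn_smul, Pi.add_apply, Pi.smul_apply, hs, smul_eq_mul]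
      have e1 : m + 1 = n ↔ m = n - 1 := by omega
      have e2 : m - 1 = n ↔ m = n + 1 := by omega
      simp only [e1, e2]
      by_cases hm : m = n
      · rw [hm]
      · simp [hm])
  have h1 := h v
  have hi : ∀ k, inner ℂ (s k) y = y k := by
    intro k
    rw [lp.inner_single_left]
    simp
  rw [hv', hv, inner_sub_left, inner_add_left, inner_add_left, inner_smul_left, inner_smul_left,
    hi, hi, hi, Complex.conj_ofReal, sub_eq_zero] at h1
  rw [lp.coeFn_smul, Pi.smul_apply, smul_eq_mul, ← h1]
  ring

theorem exists_isResolventAt_hamiltonian {z : ℂ} (hz : z.im ≠ 0) :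
    ∃ R : L2 →L[ℂ] L2, IsResolventAt (hamiltonian V) z R := by
  refine exists_isResolventAt (isClosed_graph_hamiltonian V) (abs_pos.2 hz)
    (abs_im_mul_norm_le hamiltonian_symm z) fun y hy => ?_
  obtain ⟨v, rfl, hv⟩ := exists_eigenvector_of_orthogonal hy
  by_contra hne
  have := eigenvalue_im_eq_zero hamiltonian_symm ⟨hne, hv⟩
  exact hz (by simpa using this)

theorem isSelfAdjointOperator_hamiltonian (V : ℤ → ℝ) :
    IsSelfAdjointOperator (hamiltonian V) :=
  ⟨hamiltonian_symm, exists_isResolventAt_hamiltonian (by simp),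
    exists_isResolventAt_hamiltonian (by simp)⟩

/-- A solution of `Hψ = zψ` which vanishes at two adjacent sites vanishes identically. -/
theorem eq_zero_of_eq_zero_zero_one {z : ℂ} {ψ : (hamiltonian V).domain}
    (h : hamiltonian V ψ = z • (ψ : L2)) (h0 : (ψ : L2) 0 = 0) (h1 : (ψ : L2) 1 = 0) :
    (ψ : L2) = 0 := by
  have hrec : ∀ n : ℤ, (ψ : L2) (n + 1) + (ψ : L2) (n - 1) + (V n : ℂ) * (ψ : L2) n =
      z * (ψ : L2) n := by
    intro n
    rw [← hamiltonian_apply, h]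
    rfl
  have key : ∀ n : ℤ, (ψ : L2) n = 0 ∧ (ψ : L2) (n + 1) = 0 := by
    intro n
    induction n using Int.induction_on with
    | zero => exact ⟨h0, by simpa using h1⟩
    | succ i hi =>
      refine ⟨hi.2, ?_⟩
      have := hrec (i + 1)
      rw [add_sub_cancel_right, hi.1, hi.2] at this
      simpa using this
    | pred i hi =>
      rw [sub_add_cancel]
      refine ⟨?_, hi.1⟩
      have := hrec (-i)
      rw [hi.1, hi.2] at this
      simpa using this
  exact lp.ext (funext fun n => (key n).1)

theorem plusPart_apply (ψ : L2) (n : ℤ) : plusPart ψ n = if 0 < n then ψ n else 0 := by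
  change (Set.Ioi (0 : ℤ)).indicator (ψ : ℤ → ℂ) n = _
  simp [Set.indicator_apply]

theorem minusPart_apply (ψ : L2) (n : ℤ) : minusPart ψ n = if n < 0 then ψ n else 0 := by
  change (Set.Iio (0 : ℤ)).indicator (ψ : ℤ → ℂ) n = _
  simp [Set.indicator_apply]

theorem e0_apply (n : ℤ) : e0 n = if n = 0 then 1 else 0 := by
  simp [e0, Pi.single_apply]

theorem inner_plusPart_minusPart (φ ψ : L2) : inner ℂ (plusPart φ) (minusPart ψ) = 0 := by
  refine (hasSum_inner_apply (plusPart φ) (minusPart ψ)).unique ?_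
  convert hasSum_zero using 2 with n
  rw [plusPart_apply, minusPart_apply]
  rcases lt_trichotomy n 0 with h | rfl | h
  · simp [h.le]
  · simp
  · simp [h.le]

theorem norm_plusPart_sq_add_norm_minusPart_sq {ψ : L2} (h0 : ψ 0 = 0) :
    ‖plusPart ψ‖ ^ 2 + ‖minusPart ψ‖ ^ 2 = ‖ψ‖ ^ 2 := by
  have h1 : ψ = plusPart ψ + minusPart ψ := by
    refine lp.ext (funext fun n => ?_)
    rw [lp.coeFn_add, Pi.add_apply, plusPart_apply, minusPart_apply]
    rcases lt_trichotomy n 0 with h | rfl | h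
    · simp [h, h.le]
    · simp [h0]
    · simp [h, h.le]
  conv_rhs => rw [h1]
  rw [sq, sq, sq, norm_add_sq_eq_norm_sq_add_norm_sq_of_inner_eq_zero _ _
    (inner_plusPart_minusPart ψ ψ)]

/-- As `φ 0 = 0`, truncation changes nothing at site `1`. Only at site `0` does the neighbour `φ 1`
lose its counterpart `φ (-1)`. -/
theorem exists_plusPart {z : ℂ} {φ : (hamiltonian V).domain}
    (h : hamiltonian V φ = z • (φ : L2)) (h0 : (φ : L2) 0 = 0) :
    ∃ v : (hamiltonian V).domain, (v : L2) = plusPart φ ∧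
      hamiltonian V v = z • plusPart φ + (φ : L2) 1 • e0 := by
  refine exists_hamiltonian_eq fun n => ?_
  have hrec : (hamiltonian V φ : L2) n = z * (φ : L2) n := by rw [h]; rfl
  rw [hamiltonian_apply] at hrec
  simp only [lp.coeFn_add, lp.coeFn_smul, Pi.add_apply, Pi.smul_apply, smul_eq_mul,
    plusPart_apply, e0_apply]
  rcases lt_trichotomy n 0 with hn | rfl | hn
  · simp [hn.not_gt, hn.ne, show ¬ 0 < n + 1 by omega,
      show ¬ 1 < n by omega]
  · simp
  · rcases eq_or_ne n 1 with rfl | h1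
    · simp [h0] at hrec ⊢
      exact hrec.symm
    · simp [hn, hn.ne', show 0 < n + 1 by omega, show 1 < n by omega]
      exact hrec.symm

/-- The defect at the origin is `φ (-1)`, which is `-φ 1` by the equation at site `0`. -/
theorem exists_minusPart {z : ℂ} {φ : (hamiltonian V).domain}
    (h : hamiltonian V φ = z • (φ : L2)) (h0 : (φ : L2) 0 = 0) :
    ∃ v : (hamiltonian V).domain, (v : L2) = minusPart φ ∧
      hamiltonian V v = z • minusPart φ - (φ : L2) 1 • e0 := by
  refine exists_hamiltonian_eq fun n => ?_
  have hrec : ∀ n, (hamiltonian V φ : L2) n = z * (φ : L2) n := fun n => by rw [h]; rfl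
  simp only [hamiltonian_apply] at hrec
  have h00 := hrec 0
  rw [h0, mul_zero, mul_zero, add_zero, zero_add] at h00
  have hrec := hrec n
  simp only [lp.coeFn_sub, lp.coeFn_smul, Pi.sub_apply, Pi.smul_apply, smul_eq_mul,
    minusPart_apply, e0_apply]
  rcases lt_trichotomy n 0 with hn | rfl | hn
  · rcases eq_or_ne n (-1) with rfl | h1
    · simp [h0] at hrec ⊢
      exact hrec.symm
    · simp [hn, hn.ne, show n + 1 < 0 by omega, show n < 1 by omega]
      exact hrec.symm
  · simp at h00 ⊢
    linear_combination -h00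
  · simp [hn.not_gt, hn.ne', show ¬ n + 1 < 0 by omega, show ¬ n < 1 by omega]

end Hamiltonian

theorem ball_infDist_frontier_subset {X : Type*} [SeminormedAddCommGroup X] [NormedSpace ℝ X]
    {J : Set X} (hJ : IsOpen J) {a : X} (ha : a ∈ J) :
    Metric.ball a (Metric.infDist a (frontier J)) ⊆ J := by
  -- If the frontier is empty, `infDist` is `0` by convention and the ball is empty.
  rcases Set.eq_empty_or_nonempty (Metric.ball a (Metric.infDist a (frontier J))) with h | h
  · rw [h]
    exact Set.empty_subset _
  refine (convex_ball a _).isPreconnected.subset_left_of_subset_union hJ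
    isClosed_closure.isOpen_compl (disjoint_compl_right.mono_left subset_closure) ?_
    ⟨a, Metric.mem_ball_self (Metric.nonempty_ball.1 h), ha⟩
  intro b hb
  by_contra hbJ
  rw [Set.mem_union, not_or, Set.notMem_compl_iff] at hbJ
  refine Set.disjoint_left.1 Metric.disjoint_ball_infDist hb ?_
  rw [hJ.frontier_eq]
  exact ⟨hbJ.2, hbJ.1⟩

/-! ### Separation of the eigenvalues in `J` -/

section Main

variable {V : ℤ → ℝ} {J : Set ℝ}

/-- With `P` the projector, `φ 0 = ⟨e₀, P φ⟩ = ⟨P e₀, φ⟩ = 0`. -/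
theorem apply_zero_eq_zero (hJ : IsOpen J) (he0 : spectralProjector (hamiltonian V) J e0 = 0)
    {a : ℝ} (ha : a ∈ J) {φ : (hamiltonian V).domain}
    (hφ : hamiltonian V φ = (a : ℂ) • (φ : L2)) : (φ : L2) 0 = 0 := by
  by_cases hne : (φ : L2) = 0
  · rw [hne]
    rfl
  have hmem := (isSelfAdjointOperator_hamiltonian V).eigenvector_mem_spectralSubspace hJ ha
    ⟨hne, hφ⟩
  have h1 : inner ℂ e0 (φ : L2) = 0 := by
    rw [← Submodule.starProjection_eq_self_iff.2 hmem,
      ← Submodule.inner_starProjection_left_eq_right]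
    change inner ℂ (spectralProjector (hamiltonian V) J e0) (φ : L2) = 0
    rw [he0, inner_zero_left]
  rw [e0, lp.inner_single_left] at h1
  simpa using h1

/-- If `(H - a) w` is a multiple of `e₀`, then `1_J(H) w` is an eigenvector at `a`; this eigenvalue
is simple. -/
theorem exists_spectralProjector_eq_smul (hJ : IsOpen J)
    (he0 : spectralProjector (hamiltonian V) J e0 = 0) {a : ℝ} (ha : a ∈ J)
    {φ : (hamiltonian V).domain} (hφ : IsEigenvector (hamiltonian V) (a : ℂ) φ)
    {w : (hamiltonian V).domain} {c : ℂ} (hw : hamiltonian V w = (a : ℂ) • (w : L2) + c • e0) :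
    ∃ α : ℂ, spectralProjector (hamiltonian V) J w = α • (φ : L2) := by
  have h0 := apply_zero_eq_zero hJ he0 ha hφ.2
  have h1 : (φ : L2) 1 ≠ 0 := fun h => hφ.1 (eq_zero_of_eq_zero_zero_one hφ.2 h0 h)
  obtain ⟨v, hv, hv'⟩ :=
    (isSelfAdjointOperator_hamiltonian V).exists_spectralProjector_eq J w
  rw [hw, map_add, map_smul, map_smul, he0, smul_zero, add_zero, ← hv] at hv'
  have hv0 := apply_zero_eq_zero hJ he0 ha hv'
  -- Both solutions vanish at `0`; this factor makes them agree at `1`.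
  refine ⟨(v : L2) 1 / (φ : L2) 1, ?_⟩
  rw [← hv, ← sub_eq_zero]
  refine eq_zero_of_eq_zero_zero_one (z := a) (ψ := v - ((v : L2) 1 / (φ : L2) 1) • φ) ?_ ?_ ?_
  · rw [LinearPMap.map_sub, LinearPMap.map_smul, hv', hφ.2]
    simp only [Submodule.coe_sub, Submodule.coe_smul]
    rw [smul_sub, smul_comm]
  · change (v : L2) 0 - ((v : L2) 1 / (φ : L2) 1) * (φ : L2) 0 = 0
    rw [hv0, h0, mul_zero, sub_zero]
  · change (v : L2) 1 - ((v : L2) 1 / (φ : L2) 1) * (φ : L2) 1 = 0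
    rw [div_mul_cancel₀ _ h1, sub_self]

theorem inner_eq_zero_of_ne {a b : ℝ} (hab : a ≠ b) {φ ψ : (hamiltonian V).domain}
    (hφ : hamiltonian V φ = (a : ℂ) • (φ : L2)) (hψ : hamiltonian V ψ = (b : ℂ) • (ψ : L2)) :
    inner ℂ (φ : L2) (ψ : L2) = 0 := by
  have h := hamiltonian_symm φ ψ
  rw [hφ, hψ, inner_smul_left, inner_smul_right, Complex.conj_ofReal, ← sub_eq_zero,
    ← sub_mul, mul_eq_zero, sub_eq_zero, Complex.ofReal_inj] at h
  exact h.resolve_left hab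

/-- Two eigenvalues in `J` are at least as far apart as each of them is from the complement of `J`.
The half-line pieces `φ₊` and `ψ₋` are glued into a trial vector `w` for which `(H - a) w` is a
multiple of `ψ₋`. -/
theorem le_abs_sub_of_eigenvectors (hJ : IsOpen J)
    (he0 : spectralProjector (hamiltonian V) J e0 = 0) {a b r : ℝ} (ha : a ∈ J) (hb : b ∈ J)
    (hab : a ≠ b) (hr : Set.Ioo (a - r) (a + r) ⊆ J) {φ ψ : (hamiltonian V).domain}
    (hφ : IsEigenvector (hamiltonian V) (a : ℂ) φ) (hψ : IsEigenvector (hamiltonian V) (b : ℂ) ψ) :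
    r ≤ |a - b| := by
  rcases le_or_gt r 0 with hr0 | hr0
  · exact hr0.trans (abs_nonneg _)
  have hH := isSelfAdjointOperator_hamiltonian V
  have hφ0 := apply_zero_eq_zero hJ he0 ha hφ.2
  have hψ0 := apply_zero_eq_zero hJ he0 hb hψ.2
  have hφ1 : (φ : L2) 1 ≠ 0 := fun h => hφ.1 (eq_zero_of_eq_zero_zero_one hφ.2 hφ0 h)
  have hψ1 : (ψ : L2) 1 ≠ 0 := fun h => hψ.1 (eq_zero_of_eq_zero_zero_one hψ.2 hψ0 h)
  obtain ⟨u, hu, hHu⟩ := exists_plusPart hφ.2 hφ0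
  obtain ⟨v, hv, hHv⟩ := exists_minusPart hψ.2 hψ0
  rw [← hu] at hHu
  rw [← hv] at hHv
  obtain ⟨α, hα⟩ := exists_spectralProjector_eq_smul hJ he0 ha hφ hHu
  obtain ⟨β, hβ⟩ := exists_spectralProjector_eq_smul hJ he0 hb hψ (w := v) (c := -(ψ : L2) 1)
    (by rw [hHv, neg_smul, sub_eq_add_neg])
  set P := spectralProjector (hamiltonian V) J with hP
  have hPmem : ∀ x, P x ∈ spectralSubspace (hamiltonian V) J := fun x =>
    Submodule.starProjection_apply_mem _ x
  have hPorth : ∀ x, x - P x ∈ (spectralSubspace (hamiltonian V) J)ᗮ := fun x =>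
    Submodule.sub_starProjection_mem_orthogonal x
  set f := (u : L2) - P u with hf
  set g := (v : L2) - P v with hg
  -- `φ₊` and `ψ₋` have disjoint supports, and their projections are multiples of the orthogonal
  -- vectors `φ` and `ψ`.
  have hfg : inner ℂ f g = 0 := by
    have h1 : inner ℂ f (P v) = 0 := (Submodule.mem_orthogonal' _ _).1 (hPorth u) _ (hPmem v)
    have h2 : inner ℂ (P u) g = 0 := (Submodule.mem_orthogonal _ _).1 (hPorth v) _ (hPmem u)
    have h3 : inner ℂ (P u) (P v) = 0 := by
      rw [hα, hβ, inner_smul_left, inner_smul_right, inner_eq_zero_of_ne hab hφ.2 hψ.2, mul_zero,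
        mul_zero]
    have h4 : inner ℂ (u : L2) (v : L2) = 0 := by
      rw [hu, hv]
      exact inner_plusPart_minusPart _ _
    rw [hg, inner_sub_right, h3, sub_zero] at h2
    rw [hg, inner_sub_right, h1, sub_zero, hf, inner_sub_left, h4, h2, sub_zero]
  -- Otherwise `ψ₋ = β ψ`. Site `1` forces `β = 0`, so `ψ₋ = 0`, against the defect `-ψ(1) e₀`.
  have hg0 : g ≠ 0 := by
    intro h
    rw [hg, hβ, sub_eq_zero, hv] at h
    have e1 := congrArg (fun x : L2 => x 1) h
    simp only [minusPart_apply, lp.coeFn_smul, Pi.smul_apply, smul_eq_mul] at e1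
    have hβ0 : β = 0 := by simpa [hψ1] using e1.symm
    rw [hβ0, zero_smul] at h
    have e2 : (hamiltonian V v : L2) 0 = (b : ℂ) * (v : L2) 0 - (ψ : L2) 1 * e0 0 := by
      rw [hHv]
      rfl
    rw [hamiltonian_apply, hv.trans h] at e2
    simp [e0_apply, hψ1] at e2
  -- The weights cancel the two multiples of `e₀`.
  let w : (hamiltonian V).domain := (ψ : L2) 1 • u + (φ : L2) 1 • v
  obtain ⟨p, hp, hHp⟩ := hH.exists_spectralProjector_eq J w
  have hwc : (w : L2) = (ψ : L2) 1 • (u : L2) + (φ : L2) 1 • (v : L2) := rfl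
  have hHw : hamiltonian V w = (ψ : L2) 1 • ((a : ℂ) • (u : L2)) +
      (φ : L2) 1 • ((b : ℂ) • (v : L2)) := by
    rw [LinearPMap.map_add, LinearPMap.map_smul, LinearPMap.map_smul, hHu, hHv]
    module
  have hq : ((w - p : (hamiltonian V).domain) : L2) = (ψ : L2) 1 • f + (φ : L2) 1 • g := by
    rw [Submodule.coe_sub, hp, ← hP, hwc, map_add, map_smul, map_smul, hf, hg]
    module
  have hHq : hamiltonian V (w - p) - (a : ℂ) • ((w - p : (hamiltonian V).domain) : L2) =
      ((φ : L2) 1 * ((b : ℂ) - a)) • g := by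
    rw [hq, LinearPMap.map_sub, hHp, hHw, ← hP]
    simp only [map_add, map_smul]
    rw [hf, hg]
    module
  have hgap := hH.mul_norm_le_of_mem_orthogonal hr (v := w - p) (by
    rw [hq]
    exact Submodule.add_mem _ (Submodule.smul_mem _ _ (hPorth _))
      (Submodule.smul_mem _ _ (hPorth _)))
  rw [hHq, hq] at hgap
  have hpyth : ‖(φ : L2) 1 • g‖ ≤ ‖(ψ : L2) 1 • f + (φ : L2) 1 • g‖ := by
    have h1 := norm_add_sq_eq_norm_sq_add_norm_sq_of_inner_eq_zero ((ψ : L2) 1 • f)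
      ((φ : L2) 1 • g) (𝕜 := ℂ) (by rw [inner_smul_left, inner_smul_right, hfg, mul_zero, mul_zero])
    rw [mul_self_le_mul_self_iff (norm_nonneg _) (norm_nonneg _), h1]
    exact le_add_of_nonneg_left (mul_self_nonneg _)
  have hpos : 0 < ‖(φ : L2) 1‖ * ‖g‖ := mul_pos (norm_pos_iff.2 hφ1) (norm_pos_iff.2 hg0)
  have hab' : ‖(b : ℂ) - a‖ = |a - b| := by
    rw [← Complex.ofReal_sub, Complex.norm_real, Real.norm_eq_abs, abs_sub_comm]
  have h2 := (mul_le_mul_of_nonneg_left hpyth hr0.le).trans hgap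
  rw [norm_smul, norm_smul, norm_mul, hab'] at h2
  refine le_of_mul_le_mul_right ?_ hpos
  linarith

theorem delta_pos {φ : L2} (hp : φ 1 ≠ 0) (hm : φ (-1) ≠ 0) : 0 < delta φ := by
  have h1 : plusPart φ ≠ 0 := fun h => by
    have := congrArg (fun x : L2 => x 1) h
    simp [plusPart_apply, hp] at this
  have h2 : minusPart φ ≠ 0 := fun h => by
    have := congrArg (fun x : L2 => x (-1)) h
    simp [minusPart_apply, hm] at this
  have h3 : φ ≠ 0 := by
    rintro rfl
    exact hp rfl
  exact div_pos (lt_min (norm_pos_iff.2 h1) (norm_pos_iff.2 h2)) (norm_pos_iff.2 h3)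

/-- Failure would make both halves of `ψ` larger than both halves of `φ`, against equal total mass.
-/
theorem mConst_le {φ ψ : L2} (h : ‖plusPart φ‖ ^ 2 + ‖minusPart φ‖ ^ 2 =
    ‖plusPart ψ‖ ^ 2 + ‖minusPart ψ‖ ^ 2) :
    mConst φ ψ ≤ max ‖plusPart φ‖ ‖minusPart φ‖ := by
  rw [mConst, min_le_iff]
  by_contra! hcon
  obtain ⟨h1, h2⟩ := hcon
  have ha : max ‖plusPart φ‖ ‖minusPart φ‖ < ‖plusPart ψ‖ :=
    (lt_max_iff.1 h1).resolve_left (le_max_right _ _).not_gt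
  have hb : max ‖plusPart φ‖ ‖minusPart φ‖ < ‖minusPart ψ‖ :=
    (lt_max_iff.1 h2).resolve_left (le_max_left _ _).not_gt
  have ha' := pow_lt_pow_left₀ ((le_max_left _ _).trans_lt ha) (norm_nonneg _) two_ne_zero
  have hb' := pow_lt_pow_left₀ ((le_max_right _ _).trans_lt hb) (norm_nonneg _) two_ne_zero
  linarith

theorem max_le_sqrt {φ : L2} (hn : ‖φ‖ = 1) (h : ‖plusPart φ‖ ^ 2 + ‖minusPart φ‖ ^ 2 = 1) :
    max ‖plusPart φ‖ ‖minusPart φ‖ ≤ √(1 - delta φ ^ 2) := by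
  refine Real.le_sqrt_of_sq_le ?_
  rw [delta, hn, div_one]
  rcases le_total ‖plusPart φ‖ ‖minusPart φ‖ with hle | hle
  · rw [max_eq_right hle, min_eq_left hle]
    linarith
  · rw [max_eq_left hle, min_eq_right hle]
    linarith

theorem mConst_nonneg (φ ψ : L2) : 0 ≤ mConst φ ψ :=
  le_min (le_max_of_le_left (norm_nonneg _)) (le_max_of_le_left (norm_nonneg _))

theorem exists_eigenvalue_near (hpp : IsPurePointOn (hamiltonian V) J) {a r : ℝ} (hr : 0 < r)
    (hJ : Set.Ioo (a - r) (a + r) ⊆ J) (ha : (a : ℂ) ∈ unboundedSpectrum (hamiltonian V)) :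
    ∃ b ∈ Set.Ioo (a - r) (a + r), IsEigenvalue (hamiltonian V) (b : ℂ) := by
  refine (isSelfAdjointOperator_hamiltonian V).exists_eigenvalue_of_mem_spectrum
    (isClosed_graph_hamiltonian V) hpp hr hJ ha fun y hy => ?_
  have h := exists_eigenvector_of_orthogonal hy
  rwa [Complex.conj_ofReal] at h

/-- An eigenvalue in `J` is isolated from all other eigenvalues. -/
theorem exists_isolating_radius (hJ : IsOpen J)
    (he0 : spectralProjector (hamiltonian V) J e0 = 0) {a : ℝ} (ha : a ∈ J)
    (hev : IsEigenvalue (hamiltonian V) (a : ℂ)) :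
    ∃ r > 0, ∀ b : ℝ, IsEigenvalue (hamiltonian V) (b : ℂ) → b ≠ a → r ≤ |a - b| := by
  obtain ⟨r, hr, hrJ⟩ := Metric.isOpen_iff.1 hJ a ha
  refine ⟨r, hr, fun b hb hne => ?_⟩
  by_contra! hlt
  have hbJ : b ∈ J := hrJ (by rwa [Metric.mem_ball, Real.dist_eq, abs_sub_comm])
  obtain ⟨φ, hφ⟩ := hev
  obtain ⟨ψ, hψ⟩ := hb
  rw [Real.ball_eq_Ioo] at hrJ
  exact hlt.not_ge (le_abs_sub_of_eigenvectors hJ he0 ha hbJ hne.symm hrJ hφ hψ)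

end Main

end Schrodinger

/-! ### The three conclusions -/

theorem corollary2p2 (V : ℤ → ℝ) (J : Set ℝ) (hJ_open : IsOpen J) (hJ_interval : J.OrdConnected)
    (hpp : Schrodinger.IsPurePointOn (Schrodinger.hamiltonian V) J)
    (he0 : Schrodinger.spectralProjector (Schrodinger.hamiltonian V) J Schrodinger.e0 = 0) :
    -- the quantitative estimate for two eigenfunctions
    (∀ (lam mu : ℝ) (φ ψ : (Schrodinger.hamiltonian V).domain), lam ∈ J → mu ∈ J → lam ≠ mu →
      Schrodinger.IsEigenvector (Schrodinger.hamiltonian V) (lam : ℂ) φ →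
      Schrodinger.IsEigenvector (Schrodinger.hamiltonian V) (mu : ℂ) ψ →
      ‖(φ : Schrodinger.L2)‖ = 1 → ‖(ψ : Schrodinger.L2)‖ = 1 →
        0 < Schrodinger.delta φ ∧
        Schrodinger.mConst φ ψ ≤
          max ‖Schrodinger.plusPart φ‖ ‖Schrodinger.minusPart φ‖ ∧
        max ‖Schrodinger.plusPart φ‖ ‖Schrodinger.minusPart φ‖ ≤
          √(1 - Schrodinger.delta φ ^ 2) ∧
        Metric.infDist lam (frontier J) ≤ |lam - mu| / √(1 - Schrodinger.mConst φ ψ ^ 2)) ∧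
    -- no eigenvalue in `J` is a limit point of other eigenvalues
    (∀ lam ∈ J, Schrodinger.IsEigenvalue (Schrodinger.hamiltonian V) (lam : ℂ) →
      ¬ AccPt lam (Filter.principal
        {mu : ℝ | Schrodinger.IsEigenvalue (Schrodinger.hamiltonian V) (mu : ℂ)})) ∧
    -- the spectrum in `J` contains no nondegenerate interval
    (∀ I : Set ℝ, I.OrdConnected → I.Nontrivial →
      ¬ I ⊆ {x : ℝ | (x : ℂ) ∈
        Schrodinger.unboundedSpectrum (Schrodinger.hamiltonian V)} ∩ J) := by
  refine ⟨?_, ?_, ?_⟩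
  · intro lam mu φ ψ hlam hmu hne hφ hψ hnφ hnψ
    have hφ0 := Schrodinger.apply_zero_eq_zero hJ_open he0 hlam hφ.2
    have hψ0 := Schrodinger.apply_zero_eq_zero hJ_open he0 hmu hψ.2
    have hφ1 : (φ : Schrodinger.L2) 1 ≠ 0 := fun h =>
      hφ.1 (Schrodinger.eq_zero_of_eq_zero_zero_one hφ.2 hφ0 h)
    -- The equation at site `0` gives `φ (-1) = -φ 1`.
    have hφm : (φ : Schrodinger.L2) (-1) ≠ 0 := by
      intro h
      have h1 := congrArg (fun x : Schrodinger.L2 => x 0) hφ.2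
      rw [Schrodinger.hamiltonian_apply] at h1
      rw [lp.coeFn_smul, Pi.smul_apply, hφ0, zero_sub, h] at h1
      simp [hφ1] at h1
    have hsφ := Schrodinger.norm_plusPart_sq_add_norm_minusPart_sq hφ0
    have hsψ := Schrodinger.norm_plusPart_sq_add_norm_minusPart_sq hψ0
    rw [hnφ, one_pow] at hsφ
    rw [hnψ, one_pow] at hsψ
    have hδ := Schrodinger.delta_pos hφ1 hφm
    have hm := Schrodinger.mConst_le (hsφ.trans hsψ.symm)
    have hmax := Schrodinger.max_le_sqrt hnφ hsφ
    refine ⟨hδ, hm, hmax, ?_⟩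
    have hm0 := Schrodinger.mConst_nonneg (φ : Schrodinger.L2) ψ
    have hm1 : Schrodinger.mConst φ ψ < 1 := by
      refine (hm.trans hmax).trans_lt ?_
      rw [Real.sqrt_lt' one_pos]
      nlinarith [pow_pos hδ 2]
    have hpos : 0 < √(1 - Schrodinger.mConst φ ψ ^ 2) := Real.sqrt_pos.2 (by nlinarith)
    have hle : √(1 - Schrodinger.mConst φ ψ ^ 2) ≤ 1 :=
      Real.sqrt_le_one.2 (by nlinarith [sq_nonneg (Schrodinger.mConst φ ψ)])
    have hball := Schrodinger.ball_infDist_frontier_subset hJ_open hlam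
    rw [Real.ball_eq_Ioo] at hball
    have hd := Schrodinger.le_abs_sub_of_eigenvectors hJ_open he0 hlam hmu hne hball hφ hψ
    -- Dividing by a square root in `(0, 1]` only weakens the bound.
    exact hd.trans (le_div_self (abs_nonneg _) hpos hle)
  · intro lam hlam hev hacc
    obtain ⟨r, hr, hiso⟩ := Schrodinger.exists_isolating_radius hJ_open he0 hlam hev
    rw [accPt_iff_frequently] at hacc
    obtain ⟨b, ⟨hb, hbev⟩, hbr⟩ := (hacc.and_eventually (Metric.ball_mem_nhds lam hr)).exists
    rw [Real.dist_eq, abs_sub_comm] at hbr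
    exact hbr.not_ge (hiso b hbev hb)
  · intro I hI hnt hsub
    obtain ⟨x, hx, y, hy, hxy⟩ := hnt.exists_lt
    have hIcc := hI.out hx hy
    have hev : ∀ s t : ℝ, x ≤ s → s < t → t ≤ y →
        ∃ b ∈ Set.Ioo s t, Schrodinger.IsEigenvalue (Schrodinger.hamiltonian V) (b : ℂ) := by
      intro s t hs hst ht
      have e1 : (s + t) / 2 - (t - s) / 2 = s := by ring
      have e2 : (s + t) / 2 + (t - s) / 2 = t := by ring
      have h := Schrodinger.exists_eigenvalue_near hpp (a := (s + t) / 2) (r := (t - s) / 2)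
        (by linarith)
        (by
          rw [e1, e2]
          intro c hc
          exact (hsub (hIcc ⟨hs.trans hc.1.le, hc.2.le.trans ht⟩)).2)
        (hsub (hIcc ⟨by linarith, by linarith⟩)).1
      rwa [e1, e2] at h
    obtain ⟨a, ha, haev⟩ := hev x y le_rfl hxy le_rfl
    obtain ⟨r, hr, hiso⟩ := Schrodinger.exists_isolating_radius hJ_open he0
      (hsub (hIcc ⟨ha.1.le, ha.2.le⟩)).2 haev
    -- A second eigenvalue, within the isolating radius of `a`.
    obtain ⟨b, hb, hbev⟩ := hev a (min y (a + r)) ha.1.le (lt_min ha.2 (by linarith))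
      (min_le_left _ _)
    have h1 := hiso b hbev hb.1.ne'
    have h2 := hb.2.trans_le (min_le_right _ _)
    rw [abs_sub_comm, abs_of_pos (sub_pos.2 hb.1)] at h1
    linarith
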